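/- Let $\mathbb{D}=\{z\in\mathbb{C}:|z|<1\}$. Let $\sigma$ be the class of functions $f(z)=z+\sum_{n\ge 2}a_nz^n$ that are analytic and univalent in $\mathbb{D}$ and whose inverse $f^{-1}$ (defined near $0$) extends to an analytic univalent function $g$ on $\mathbb{D}$. For $F,G$ on $\mathbb{D}$ write $F\prec G$ if there is an analytic $w:\mathbb{D}\to\mathbb{D}$ with $w(0)=0$ and $F=G\circ w$ on $\mathbb{D}$. Let $\lambda\ge 1$, $\mu\ge 0$, $t\in(1/2,1]$ be real and $H(z,t)=\frac{1}{1-2tz+z^2}$. The class $\mathcal{N}_\sigma^\mu(\lambda,t)$ consists of all $f\in\sigma$ such that $$(1-\lambda)\Big(\frac{f(z)}{z}\Big)^{\mu}+\lambda f'(z)\Big(\frac{f(z)}{z}\Big)^{\mu-1}\prec H(z,t)\quad\text{and}\quad(1-\lambda)\Big(\frac{g(w)}{w}\Big)^{\mu}+\lambda g'(w)\Big(\frac{g(w)}{w}\Big)^{\mu-1}\prec H(w,t),$$ where the powers are the analytic branches on $\mathbb{D}$ with value $1$ at $0$. Put $$\begin{aligned}M_1={}&16t^2\left|3(2t^2-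1)(\lambda+\mu)^3-(\mu^2+3\mu+2)(3\lambda+\mu)t^2\right|(2\lambda+\mu)^2\\&-24t\left[t^2(3\lambda+\mu)+(4t^2-1)(\lambda+\mu)(2\lambda+\mu)\right](\lambda+\mu)^2(2\lambda+\mu)-24t^2\lambda^2(\lambda+\mu)^3,\\M_2={}&8t\big[t^2(2\lambda+\mu)(3\lambda+\mu)+(4t^2-1)(\lambda+\mu)(2\lambda+\mu)^2\\&+t(2\lambda+\mu)^2(\lambda+\mu)-2t(\lambda+\mu)^2(3\lambda+\mu)\big](\lambda+\mu)^2,\end{aligned}$$ $$K_2=\frac{4t^2}{(2\lambda+\mu)^2}+\frac{M_1+3M_2}{6(\lambda+\mu)^4(2\lambda+\mu)^2(3\lambda+\mu)},$$ and, when $M_1<0$, $$K_0=\frac{4t^2}{(2\lambda+\mu)^2}-\frac{3M_2^2}{8M_1(\lambda+\mu)^4(2\lambda+\mu)^2(3\lambda+\mu)}.$$ If $f(z)=z+\sum_{n\ge2}a_nz^n$ is in $\mathcal{N}_\sigma^\mu(\lambda,t)$, then $$|a_2a_4-a_3^2|\le\begin{cases}K_2,&M_1\ge0\text{ and }M_2\ge0,\\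 \max\left\{\frac{4t^2}{(2\lambda+\mu)^2},K_2\right\},&M_1>0\text{ and }M_2<0,\\ \frac{4t^2}{(2\lambda+\mu)^2},&M_1\le0\text{ and }M_2\le0,\\ \max\{K_0,K_2\},&M_1<0\text{ and }M_2>0.\end{cases}$$ -/

import Mathlib

open Complex Filter Topology

noncomputable section

namespace ChebyshevBiUnivalent

/-- The open unit disk. -/
def unitDisk : Set ℂ := Metric.ball 0 1

/-- `f` belongs to `𝒮`: analytic and univalent in the unit disk, `f 0 = 0`, `f' 0 = 1`. -/
structure IsNormalizedUnivalent (f : ℂ → ℂ) : Prop where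
  analytic : DifferentiableOn ℂ f unitDisk
  injective : Set.InjOn f unitDisk
  map_zero : f 0 = 0
  deriv_zero : deriv f 0 = 1

/-- `g` is (the analytic continuation to the unit disk of) the inverse `f⁻¹`, and it is univalent
there. The germ of the inverse at `0` determines `g` on the unit disk. -/
structure IsUnivalentInverse (f g : ℂ → ℂ) : Prop where
  analytic : DifferentiableOn ℂ g unitDisk
  injective : Set.InjOn g unitDisk
  left_inverse : ∀ᶠ z in 𝓝 (0 : ℂ), g (f z) = z

/-- The class `σ` of normalized bi-univalent functions in the unit disk. -/
def IsBiUnivalent (f : ℂ → ℂ) : Prop :=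
  IsNormalizedUnivalent f ∧ ∃ g, IsUnivalentInverse f g

/-- Subordination `F ≺ G` in the unit disk, through a Schwarz function `w`. -/
def Subordinate (F G : ℂ → ℂ) : Prop :=
  ∃ w : ℂ → ℂ, DifferentiableOn ℂ w unitDisk ∧ w 0 = 0 ∧
    (∀ z ∈ unitDisk, ‖w z‖ < 1) ∧ ∀ z ∈ unitDisk, F z = G (w z)

/-- The generating function `H(z,t) = 1 / (1 - 2 t z + z²)` of the Chebyshev polynomials of the
second kind. -/
def chebyshevH (t : ℝ) (z : ℂ) : ℂ := 1 / (1 - 2 * (t : ℂ) * z + z ^ 2)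

/-- `ℓ` is the analytic branch in the unit disk of `log (f z / z)` with `ℓ 0 = 0`
(the quotient `f z / z` has the value `1` at `z = 0`). -/
structure IsLogQuotient (f ℓ : ℂ → ℂ) : Prop where
  analytic : DifferentiableOn ℂ ℓ unitDisk
  map_zero : ℓ 0 = 0
  eq_mul_exp : ∀ z ∈ unitDisk, f z = z * exp (ℓ z)

/-- `(1 - λ) (f z / z) ^ μ + λ f'(z) (f z / z) ^ (μ - 1)`, where the powers are formed with the
branch `ℓ` of `log (f z / z)`. -/
def bazilevicExpr (lam mu : ℝ) (f ℓ : ℂ → ℂ) (z : ℂ) : ℂ :=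
  (1 - (lam : ℂ)) * exp ((mu : ℂ) * ℓ z)
    + (lam : ℂ) * deriv f z * exp (((mu : ℂ) - 1) * ℓ z)

/-- `(1 - λ) (f z / z) ^ μ + λ f'(z) (f z / z) ^ (μ - 1) ≺ H(z,t)`. -/
def SatisfiesSubordination (lam mu t : ℝ) (f : ℂ → ℂ) : Prop :=
  ∃ ℓ, IsLogQuotient f ℓ ∧ Subordinate (bazilevicExpr lam mu f ℓ) (chebyshevH t)

/-- The class `N_σ^μ(λ, t)`: bi-univalent functions `f` such that both `f` and `g = f⁻¹` satisfy
the subordination condition. -/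
def ClassN (lam mu t : ℝ) (f : ℂ → ℂ) : Prop :=
  IsBiUnivalent f ∧ SatisfiesSubordination lam mu t f ∧
    ∃ g, IsUnivalentInverse f g ∧ SatisfiesSubordination lam mu t g

/-- The Taylor coefficient `a_n` of `f` at `0`. -/
def coeff (f : ℂ → ℂ) (n : ℕ) : ℂ := iteratedDeriv n f 0 / (n.factorial : ℂ)

/-- `M₁(λ, μ; t)`. -/
def M₁ (lam mu t : ℝ) : ℝ :=
  16 * t ^ 2 * |3 * (2 * t ^ 2 - 1) * (lam + mu) ^ 3
      - (mu ^ 2 + 3 * mu + 2) * (3 * lam + mu) * t ^ 2| * (2 * lam + mu) ^ 2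
    - 24 * t * (t ^ 2 * (3 * lam + mu) + (4 * t ^ 2 - 1) * (lam + mu) * (2 * lam + mu))
      * (lam + mu) ^ 2 * (2 * lam + mu)
    - 24 * t ^ 2 * lam ^ 2 * (lam + mu) ^ 3

/-- `M₂(λ, μ; t)`. -/
def M₂ (lam mu t : ℝ) : ℝ :=
  8 * t * (t ^ 2 * (2 * lam + mu) * (3 * lam + mu)
      + (4 * t ^ 2 - 1) * (lam + mu) * (2 * lam + mu) ^ 2
      + t * (2 * lam + mu) ^ 2 * (lam + mu)
      - 2 * t * (lam + mu) ^ 2 * (3 * lam + mu)) * (lam + mu) ^ 2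

/-- `K(2⁻, t)`. -/
def KTwo (lam mu t : ℝ) : ℝ :=
  4 * t ^ 2 / (2 * lam + mu) ^ 2
    + (M₁ lam mu t + 3 * M₂ lam mu t)
      / (6 * (lam + mu) ^ 4 * (2 * lam + mu) ^ 2 * (3 * lam + mu))

/-- `K(c₀, t)`, used only when `M₁ < 0`. -/
def KCrit (lam mu t : ℝ) : ℝ :=
  4 * t ^ 2 / (2 * lam + mu) ^ 2
    - 3 * M₂ lam mu t ^ 2
      / (8 * M₁ lam mu t * (lam + mu) ^ 4 * (2 * lam + mu) ^ 2 * (3 * lam + mu))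

end ChebyshevBiUnivalent

end

/-!
The Hankel determinant `a₂ a₄ - a₃²` is estimated through the Schwarz functions `w`, `v` of the two
subordinations.

The class expression for `f = z exp ℓ` equals `exp (μ ℓ) (1 + λ z ℓ')`, so comparing coefficients
with `H ∘ w` gives three equations between `a₂, a₃, a₄` and the coefficients `c₁, c₂, c₃` of `w`
(`exists_coeff_eq_of_satisfiesSubordination`). The same equations hold between the coefficients of
the inverse `g`, which are polynomials in `a₂, a₃, a₄` (`coeff_inverse`), and the coefficients
`d₁, d₂, d₃` of `v`. Subtracting, one finds `d₁ = -c₁` and an expression of `a₂ a₄ - a₃²` in the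
`cᵢ`, `dᵢ` (`hankel_eq`).

Two steps of Schur's algorithm bound `|c₂|` by `(1 - |c₁|²) X` and `|c₃|` by
`(1 - |c₁|²) (1 - X² + |c₁| X²)` for some `X ∈ [0, 1]` (`schwarz_coeff`), and likewise for `v` with
some `Y`. The triangle inequality then gives a bound in `|c₁|, X, Y` which is largest for
`X = Y = 1` (`schwarz_parameter_bound`); the reason is
`(2λ + μ)² ≤ 4/3 (λ + μ)(3λ + μ)`. At `X = Y = 1` the bound is
`4 t² / (2λ + μ)²` plus a positive multiple of `M₁ u² + 3 M₂ u`, where `u = |c₁|² ∈ [0, 1]`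
(`exists_norm_hankel_le`), and the cases of the theorem bound the maximum of this quadratic
polynomial.
-/

namespace ChebyshevBiUnivalent

lemma unitDisk_mem_nhds : unitDisk ∈ 𝓝 (0 : ℂ) := Metric.ball_mem_nhds 0 one_pos

lemma zero_mem_unitDisk : (0 : ℂ) ∈ unitDisk := Metric.mem_ball_self one_pos

lemma analyticAt_zero {f : ℂ → ℂ} (hf : DifferentiableOn ℂ f unitDisk) : AnalyticAt ℂ f 0 :=
  hf.analyticAt unitDisk_mem_nhds

/-! ### Taylor coefficients -/

lemma coeff_zero (f : ℂ → ℂ) : coeff f 0 = f 0 := by simp [coeff]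

lemma coeff_one (f : ℂ → ℂ) : coeff f 1 = deriv f 0 := by simp [coeff]

lemma coeff_congr {f g : ℂ → ℂ} (h : f =ᶠ[𝓝 0] g) (n : ℕ) : coeff f n = coeff g n := by
  rw [coeff, coeff, h.iteratedDeriv_eq]

lemma coeff_add {f g : ℂ → ℂ} (hf : AnalyticAt ℂ f 0) (hg : AnalyticAt ℂ g 0) (n : ℕ) :
    coeff (fun z ↦ f z + g z) n = coeff f n + coeff g n := by
  simp only [coeff]
  rw [iteratedDeriv_fun_add hf.contDiffAt hg.contDiffAt, add_div]

lemma coeff_const_mul (c : ℂ) (f : ℂ → ℂ) (n : ℕ) :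
    coeff (fun z ↦ c * f z) n = c * coeff f n := by
  simp only [coeff]
  rw [iteratedDeriv_const_mul_field, mul_div_assoc]

lemma coeff_const_succ (c : ℂ) (n : ℕ) : coeff (fun _ ↦ c) (n + 1) = 0 := by
  simp [coeff, iteratedDeriv_const]

/-- The Cauchy product: this is Leibniz' rule divided by `n!`. -/
lemma coeff_mul {f g : ℂ → ℂ} (hf : AnalyticAt ℂ f 0) (hg : AnalyticAt ℂ g 0) (n : ℕ) :
    coeff (fun z ↦ f z * g z) n =
      ∑ p ∈ Finset.HasAntidiagonal.antidiagonal n, coeff f p.1 * coeff g p.2 := by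
  simp only [coeff]
  rw [iteratedDeriv_fun_mul hf.contDiffAt hg.contDiffAt, Finset.sum_div,
    Finset.Nat.sum_antidiagonal_eq_sum_range_succ
      (fun i j ↦ iteratedDeriv i f 0 / (i.factorial : ℂ) *
        (iteratedDeriv j g 0 / (j.factorial : ℂ)))]
  refine Finset.sum_congr rfl fun i hi ↦ ?_
  have hin : i ≤ n := Nat.lt_succ_iff.mp (Finset.mem_range.mp hi)
  rw [Nat.cast_choose ℂ hin]
  have h1 : (n.factorial : ℂ) ≠ 0 := Nat.cast_ne_zero.mpr n.factorial_ne_zero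
  have h2 : (i.factorial : ℂ) ≠ 0 := Nat.cast_ne_zero.mpr i.factorial_ne_zero
  have h3 : ((n - i).factorial : ℂ) ≠ 0 := Nat.cast_ne_zero.mpr (n - i).factorial_ne_zero
  field_simp

lemma coeff_mul_zero {f g : ℂ → ℂ} : coeff (fun z ↦ f z * g z) 0 = coeff f 0 * coeff g 0 := by
  simp [coeff_zero]

lemma coeff_mul_one {f g : ℂ → ℂ} (hf : AnalyticAt ℂ f 0) (hg : AnalyticAt ℂ g 0) :
    coeff (fun z ↦ f z * g z) 1 = coeff f 0 * coeff g 1 + coeff f 1 * coeff g 0 := by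
  simp [coeff_mul hf hg, Finset.Nat.antidiagonal_succ]

lemma coeff_mul_two {f g : ℂ → ℂ} (hf : AnalyticAt ℂ f 0) (hg : AnalyticAt ℂ g 0) :
    coeff (fun z ↦ f z * g z) 2 =
      coeff f 0 * coeff g 2 + coeff f 1 * coeff g 1 + coeff f 2 * coeff g 0 := by
  simp [coeff_mul hf hg, Finset.Nat.antidiagonal_succ, add_assoc]

lemma coeff_mul_three {f g : ℂ → ℂ} (hf : AnalyticAt ℂ f 0) (hg : AnalyticAt ℂ g 0) :
    coeff (fun z ↦ f z * g z) 3 =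
      coeff f 0 * coeff g 3 + coeff f 1 * coeff g 2 + coeff f 2 * coeff g 1
        + coeff f 3 * coeff g 0 := by
  simp [coeff_mul hf hg, Finset.Nat.antidiagonal_succ, add_assoc]

lemma analyticAt_id_mul {f : ℂ → ℂ} (hf : AnalyticAt ℂ f 0) : AnalyticAt ℂ (fun z ↦ z * f z) 0 :=
  analyticAt_id.mul hf

lemma coeff_id_mul {f : ℂ → ℂ} (hf : AnalyticAt ℂ f 0) (n : ℕ) :
    coeff (fun z ↦ z * f z) (n + 1) = coeff f n := by
  have h : ∀ i, coeff (fun z ↦ z) (i + 2) = 0 := fun i ↦ by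
    simp [coeff, iteratedDeriv_succ']
  rw [coeff_mul (f := fun z ↦ z) analyticAt_id hf, Finset.Nat.sum_antidiagonal_succ,
    coeff_zero, zero_mul, zero_add]
  cases n with
  | zero => simp [coeff_one]
  | succ n =>
    rw [Finset.Nat.sum_antidiagonal_succ, Finset.sum_eq_zero fun p _ ↦ by rw [h, zero_mul]]
    simp [coeff_one]

lemma coeff_deriv (f : ℂ → ℂ) (n : ℕ) : coeff (deriv f) n = (n + 1) * coeff f (n + 1) := by
  have h1 : (n.factorial : ℂ) ≠ 0 := Nat.cast_ne_zero.mpr n.factorial_ne_zero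
  have h2 : (n + 1 : ℂ) ≠ 0 := Nat.cast_add_one_ne_zero n
  simp only [coeff, iteratedDeriv_succ', Nat.factorial_succ]
  push_cast
  field_simp

lemma analyticAt_dslope {f : ℂ → ℂ} (hf : AnalyticAt ℂ f 0) : AnalyticAt ℂ (dslope f 0) 0 := by
  have h := hf.eventually_analyticAt
  exact ((Complex.differentiableOn_dslope h).mpr fun z hz ↦
    (hz : AnalyticAt ℂ f z).differentiableAt.differentiableWithinAt).analyticAt h

lemma eq_add_mul_dslope (f : ℂ → ℂ) (z : ℂ) : f z = f 0 + z * dslope f 0 z := by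
  have h := sub_smul_dslope f 0 z
  rw [smul_eq_mul, sub_zero] at h
  rw [h]; ring

lemma coeff_dslope {f : ℂ → ℂ} (hf : AnalyticAt ℂ f 0) (n : ℕ) :
    coeff (dslope f 0) n = coeff f (n + 1) := by
  have hd := analyticAt_dslope hf
  have h : f = fun z ↦ f 0 + z * dslope f 0 z := funext (eq_add_mul_dslope f)
  conv_rhs => rw [h]
  rw [coeff_add analyticAt_const (analyticAt_id_mul hd), coeff_const_succ, zero_add,
    coeff_id_mul hd]

lemma analyticAt_comp_id_mul {e E : ℂ → ℂ} (he : AnalyticAt ℂ e 0) (hE : AnalyticAt ℂ E 0) :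
    AnalyticAt ℂ (fun z ↦ e (z * E z)) 0 :=
  AnalyticAt.fun_comp (g := e) (f := fun z ↦ z * E z) (by rwa [zero_mul]) (analyticAt_id_mul hE)

/-- Horner's scheme for a composition: the coefficients of `e ∘ (z E)` come from those of
`(e(w) - e(0)) / w` composed with `z E`. -/
lemma coeff_comp_succ {e E : ℂ → ℂ} (he : AnalyticAt ℂ e 0) (hE : AnalyticAt ℂ E 0) (n : ℕ) :
    coeff (fun z ↦ e (z * E z)) (n + 1) =
      coeff (fun z ↦ E z * dslope e 0 (z * E z)) n := by
  have hd : AnalyticAt ℂ (fun z ↦ E z * dslope e 0 (z * E z)) 0 :=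
    hE.mul (analyticAt_comp_id_mul (analyticAt_dslope he) hE)
  have h : (fun z ↦ e (z * E z)) = fun z ↦ e 0 + z * (E z * dslope e 0 (z * E z)) := by
    funext z
    rw [eq_add_mul_dslope e (z * E z), mul_assoc]
  rw [h, coeff_add analyticAt_const (analyticAt_id_mul hd), coeff_const_succ, zero_add,
    coeff_id_mul hd]

/-- Low order coefficients of a composition with a function of the form `z E(z)`, `E(0) = 1`. -/
lemma coeff_comp {e E : ℂ → ℂ} (he : AnalyticAt ℂ e 0) (hE : AnalyticAt ℂ E 0) (hE0 : E 0 = 1) :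
    coeff (fun z ↦ e (z * E z)) 1 = coeff e 1 ∧
    coeff (fun z ↦ e (z * E z)) 2 = coeff e 2 + coeff E 1 * coeff e 1 ∧
    coeff (fun z ↦ e (z * E z)) 3 =
      coeff e 3 + 2 * coeff E 1 * coeff e 2 + coeff E 2 * coeff e 1 := by
  have key : ∀ e : ℂ → ℂ, AnalyticAt ℂ e 0 → coeff (fun z ↦ e (z * E z)) 1 = coeff e 1 ∧
      coeff (fun z ↦ e (z * E z)) 2 = coeff e 2 + coeff E 1 * coeff e 1 := by
    have key1 : ∀ e : ℂ → ℂ, AnalyticAt ℂ e 0 → coeff (fun z ↦ e (z * E z)) 1 = coeff e 1 := by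
      intro e he
      rw [coeff_comp_succ he hE, coeff_mul_zero, coeff_zero, coeff_zero, hE0, zero_mul,
        ← coeff_zero (dslope e 0), coeff_dslope he, one_mul]
    intro e he
    have hd := analyticAt_dslope he
    refine ⟨key1 e he, ?_⟩
    rw [coeff_comp_succ he hE, coeff_mul_one hE (analyticAt_comp_id_mul hd hE), key1 _ hd,
      coeff_dslope he, coeff_zero, coeff_zero, hE0, zero_mul, ← coeff_zero (dslope e 0),
      coeff_dslope he, one_mul]
  have hd := analyticAt_dslope he
  obtain ⟨h1, h2⟩ := key _ hd
  refine ⟨(key e he).1, (key e he).2, ?_⟩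
  rw [coeff_comp_succ he hE, coeff_mul_two hE (analyticAt_comp_id_mul hd hE), h1, h2,
    coeff_dslope he, coeff_dslope he, coeff_zero, coeff_zero, hE0, zero_mul,
    ← coeff_zero (dslope e 0), coeff_dslope he]
  ring

/-! ### Coefficients of bounded functions -/

open ComplexConjugate in
/-- One step of Schur's algorithm. If `‖φ 0‖ = 1`, then `φ` is constant and `χ = 0` serves. -/
lemma exists_schur_step {φ : ℂ → ℂ} (hφ : DifferentiableOn ℂ φ unitDisk)
    (hb : ∀ z ∈ unitDisk, ‖φ z‖ ≤ 1) :
    ∃ χ : ℂ → ℂ, DifferentiableOn ℂ χ unitDisk ∧ (∀ z ∈ unitDisk, ‖χ z‖ ≤ 1) ∧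
      ∀ z ∈ unitDisk, φ z * (1 + conj (φ 0) * (z * χ z)) = φ 0 + z * χ z := by
  rcases (hb 0 zero_mem_unitDisk).eq_or_lt with h0 | h0
  · have hc : Set.EqOn φ (Function.const ℂ (φ 0)) unitDisk :=
      Complex.eqOn_of_isPreconnected_of_isMaxOn_norm (convex_ball 0 1).isPreconnected
        Metric.isOpen_ball hφ zero_mem_unitDisk fun z hz ↦ by
          simpa [h0] using hb z hz
    refine ⟨fun _ ↦ 0, differentiableOn_const 0, by simp, fun z hz ↦ ?_⟩
    simpa using hc hz
  · set a := φ 0 with ha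
    have hden : ∀ z ∈ unitDisk, 1 - conj a * φ z ≠ 0 := by
      intro z hz h
      have h1 : conj a * φ z = 1 := (sub_eq_zero.mp h).symm
      have h2 : ‖a‖ * ‖φ z‖ = 1 := by
        rw [← Complex.norm_conj a, ← norm_mul, h1, norm_one]
      nlinarith [hb z hz, norm_nonneg a, norm_nonneg (φ z)]
    set ψ : ℂ → ℂ := fun z ↦ (φ z - a) / (1 - conj a * φ z) with hψ
    have hψd : DifferentiableOn ℂ ψ unitDisk :=
      (hφ.sub_const a).div ((hφ.const_mul (conj a)).const_sub 1) hden
    have hψ0 : ψ 0 = 0 := by simp [hψ, ← ha]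
    have hψb : Set.MapsTo ψ unitDisk (Metric.closedBall (ψ 0) 1) := by
      intro z hz
      rw [hψ0, mem_closedBall_zero_iff]
      simp only [hψ]
      rw [norm_div, div_le_one (norm_pos_iff.mpr (hden z hz))]
      -- `|1 - āφ|² - |φ - a|² = (1 - |a|²)(1 - |φ|²)`
      have h1 : ‖φ z‖ ^ 2 ≤ 1 := pow_le_one₀ (norm_nonneg _) (hb z hz)
      have h2 : ‖a‖ ^ 2 ≤ 1 := pow_le_one₀ (norm_nonneg _) h0.le
      refine le_of_sq_le_sq ?_ (norm_nonneg _)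
      rw [← Complex.normSq_eq_norm_sq, Complex.normSq_apply] at h1 h2
      rw [← Complex.normSq_eq_norm_sq, ← Complex.normSq_eq_norm_sq, Complex.normSq_apply,
        Complex.normSq_apply]
      simp only [sub_re, sub_im, mul_re, mul_im, conj_re, conj_im, one_re, one_im]
      nlinarith [mul_nonneg (sub_nonneg.mpr h1) (sub_nonneg.mpr h2)]
    refine ⟨dslope ψ 0, (Complex.differentiableOn_dslope unitDisk_mem_nhds).mpr hψd,
      fun z hz ↦ ?_, fun z hz ↦ ?_⟩
    · simpa using Complex.norm_dslope_le_div_of_mapsTo_ball hψd hψb hz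
    · have h := eq_add_mul_dslope ψ z
      rw [hψ0, zero_add] at h
      rw [← h]
      simp only [hψ]
      rw [← sub_eq_zero]
      have h1 := mul_inv_cancel₀ (hden z hz)
      linear_combination (a - φ z) * h1

open ComplexConjugate in
/-- The first coefficients of an analytic function bounded by `1` in terms of those of its
Schur transform `χ`. -/
lemma exists_coeff_schur {φ : ℂ → ℂ} (hφ : DifferentiableOn ℂ φ unitDisk)
    (hb : ∀ z ∈ unitDisk, ‖φ z‖ ≤ 1) :
    ∃ χ : ℂ → ℂ, DifferentiableOn ℂ χ unitDisk ∧ (∀ z ∈ unitDisk, ‖χ z‖ ≤ 1) ∧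
      coeff φ 1 = ((1 - ‖φ 0‖ ^ 2 : ℝ) : ℂ) * coeff χ 0 ∧
      coeff φ 2 = ((1 - ‖φ 0‖ ^ 2 : ℝ) : ℂ) * (coeff χ 1 - conj (φ 0) * coeff χ 0 ^ 2) := by
  obtain ⟨χ, hχ, hχb, h⟩ := exists_schur_step hφ hb
  refine ⟨χ, hχ, hχb, ?_⟩
  have aφ := analyticAt_zero hφ
  have aχ := analyticAt_zero hχ
  have az : AnalyticAt ℂ (fun z ↦ z * χ z) 0 := analyticAt_id.mul aχ
  have ac : AnalyticAt ℂ (fun z ↦ conj (φ 0) * (z * χ z)) 0 := analyticAt_const.mul az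
  have hev : (fun z ↦ φ z * (1 + conj (φ 0) * (z * χ z))) =ᶠ[𝓝 0] fun z ↦ φ 0 + z * χ z :=
    eventually_of_mem unitDisk_mem_nhds h
  have e1 := coeff_congr hev 1
  have e2 := coeff_congr hev 2
  have l1 : ∀ n, coeff (fun z ↦ 1 + conj (φ 0) * (z * χ z)) (n + 1) =
      conj (φ 0) * coeff χ n := fun n ↦ by
    rw [coeff_add analyticAt_const ac, coeff_const_succ, coeff_const_mul, coeff_id_mul aχ, zero_add]
  have l0 : coeff (fun z ↦ 1 + conj (φ 0) * (z * χ z)) 0 = 1 := by simp [coeff_zero]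
  have r1 : ∀ n, coeff (fun z ↦ φ 0 + z * χ z) (n + 1) = coeff χ n := fun n ↦ by
    rw [coeff_add analyticAt_const az, coeff_const_succ, coeff_id_mul aχ, zero_add]
  have a1 : AnalyticAt ℂ (fun z ↦ 1 + conj (φ 0) * (z * χ z)) 0 := analyticAt_const.add ac
  rw [coeff_mul_one aφ a1, l0, l1 0, r1 0, coeff_zero φ] at e1
  rw [coeff_mul_two aφ a1, l0, l1 0, l1 1, r1 1, coeff_zero φ] at e2
  have hn : ((1 - ‖φ 0‖ ^ 2 : ℝ) : ℂ) = 1 - φ 0 * conj (φ 0) := by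
    rw [Complex.mul_conj, Complex.normSq_eq_norm_sq]; push_cast; ring
  rw [hn]
  have e1' : coeff φ 1 = (1 - φ 0 * conj (φ 0)) * coeff χ 0 := by linear_combination e1
  exact ⟨e1', by linear_combination e2 - conj (φ 0) * coeff χ 0 * e1'⟩

/-- Bounds for the first three coefficients of a Schwarz function. If `χ` is the Schur transform of
`w(z) / z`, then `c₂ = (1 - |c₁|²) χ(0)`, and `c₃` involves in addition `χ'(0)`, which is at most
`1 - |χ(0)|²` in modulus; so `X = |χ(0)|`. -/
lemma schwarz_coeff {w : ℂ → ℂ} (hw : DifferentiableOn ℂ w unitDisk) (hw0 : w 0 = 0)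
    (hb : ∀ z ∈ unitDisk, ‖w z‖ < 1) :
    ‖coeff w 1‖ ≤ 1 ∧ ∃ X : ℝ, 0 ≤ X ∧ X ≤ 1 ∧
      ‖coeff w 2‖ ≤ (1 - ‖coeff w 1‖ ^ 2) * X ∧
      ‖coeff w 3‖ ≤ (1 - ‖coeff w 1‖ ^ 2) * (1 - X ^ 2 + ‖coeff w 1‖ * X ^ 2) := by
  have aw := analyticAt_zero hw
  have hφ : DifferentiableOn ℂ (dslope w 0) unitDisk :=
    (Complex.differentiableOn_dslope unitDisk_mem_nhds).mpr hw
  have hφb : ∀ z ∈ unitDisk, ‖dslope w 0 z‖ ≤ 1 := fun z hz ↦ by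
    have hm : Set.MapsTo w (Metric.ball 0 1) (Metric.closedBall (w 0) 1) := fun z hz ↦ by
      rw [hw0, mem_closedBall_zero_iff]; exact (hb z hz).le
    simpa using Complex.norm_dslope_le_div_of_mapsTo_ball hw hm hz
  obtain ⟨χ, hχ, hχb, h1, h2⟩ := exists_coeff_schur hφ hφb
  obtain ⟨η, hη, hηb, g1, -⟩ := exists_coeff_schur hχ hχb
  have hc0 : dslope w 0 0 = coeff w 1 := by rw [← coeff_zero (dslope w 0), coeff_dslope aw]
  rw [coeff_dslope aw, hc0] at h1 h2
  have hs : ‖coeff w 1‖ ≤ 1 := hc0 ▸ hφb 0 zero_mem_unitDisk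
  have hu : 0 ≤ 1 - ‖coeff w 1‖ ^ 2 := sub_nonneg.mpr (pow_le_one₀ (norm_nonneg _) hs)
  have hX : ‖χ 0‖ ≤ 1 := hχb 0 zero_mem_unitDisk
  have hX2 : 0 ≤ 1 - ‖χ 0‖ ^ 2 := sub_nonneg.mpr (pow_le_one₀ (norm_nonneg _) hX)
  refine ⟨hs, ‖χ 0‖, norm_nonneg _, hX, ?_, ?_⟩
  · rw [h1, norm_mul, Complex.norm_real, Real.norm_of_nonneg hu, coeff_zero]
  · rw [h2, norm_mul, Complex.norm_real, Real.norm_of_nonneg hu]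
    gcongr
    refine (norm_sub_le _ _).trans (add_le_add ?_ ?_)
    · rw [g1, norm_mul, Complex.norm_real, Real.norm_of_nonneg hX2, coeff_zero]
      exact mul_le_of_le_one_right hX2 (hηb 0 zero_mem_unitDisk)
    · rw [norm_mul, Complex.norm_conj, norm_pow, coeff_zero]

/-! ### Coefficient equations of the class -/

/-- The coefficients of `exp (c ℓ)`, from the differential equation `P' = c ℓ' P`. -/
lemma coeff_exp_mul {ℓ : ℂ → ℂ} (hℓ : AnalyticAt ℂ ℓ 0) (h0 : ℓ 0 = 0) (c : ℂ) :
    coeff (fun z ↦ exp (c * ℓ z)) 0 = 1 ∧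
    coeff (fun z ↦ exp (c * ℓ z)) 1 = c * coeff ℓ 1 ∧
    coeff (fun z ↦ exp (c * ℓ z)) 2 = c * coeff ℓ 2 + c ^ 2 * coeff ℓ 1 ^ 2 / 2 ∧
    coeff (fun z ↦ exp (c * ℓ z)) 3 =
      c * coeff ℓ 3 + c ^ 2 * coeff ℓ 1 * coeff ℓ 2 + c ^ 3 * coeff ℓ 1 ^ 3 / 6 := by
  set P : ℂ → ℂ := fun z ↦ exp (c * ℓ z) with hP
  have aP : AnalyticAt ℂ P 0 := (analyticAt_const.mul hℓ).cexp
  have hd : deriv P =ᶠ[𝓝 0] fun z ↦ c * (deriv ℓ z * P z) := by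
    filter_upwards [hℓ.eventually_analyticAt] with z hz
    have := ((hz.differentiableAt.hasDerivAt.const_mul c).cexp).deriv
    rw [hP, this]; ring
  have p0 : coeff P 0 = 1 := by simp [coeff_zero, hP, h0]
  have e0 := coeff_congr hd 0
  have e1 := coeff_congr hd 1
  have e2 := coeff_congr hd 2
  rw [coeff_const_mul, coeff_mul_zero, coeff_deriv, coeff_deriv, p0] at e0
  rw [coeff_const_mul, coeff_mul_one hℓ.deriv aP, coeff_deriv, coeff_deriv, coeff_deriv, p0] at e1
  rw [coeff_const_mul, coeff_mul_two hℓ.deriv aP, coeff_deriv, coeff_deriv, coeff_deriv,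
    coeff_deriv, p0] at e2
  norm_num at e0 e1 e2
  have e1' : coeff P 2 = c * coeff ℓ 2 + c ^ 2 * coeff ℓ 1 ^ 2 / 2 := by
    rw [e0] at e1; linear_combination e1 / 2
  refine ⟨p0, e0, e1', ?_⟩
  rw [e0, e1'] at e2
  linear_combination e2 / 3

/-- The coefficients of `f = z exp ℓ`. -/
lemma coeff_of_isLogQuotient {f ℓ : ℂ → ℂ} (h : IsLogQuotient f ℓ) :
    ∀ n, coeff f (n + 1) = coeff (fun z ↦ exp (ℓ z)) n := by
  intro n
  rw [coeff_congr (eventually_of_mem unitDisk_mem_nhds h.eq_mul_exp),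
    coeff_id_mul (f := fun z ↦ exp (ℓ z)) (analyticAt_zero h.analytic).cexp]

/-- Since `f' = exp ℓ (1 + z ℓ')`, the expression defining the class is `exp (μ ℓ) (1 + λ z ℓ')`. -/
lemma bazilevicExpr_eventuallyEq {lam mu : ℝ} {f ℓ : ℂ → ℂ} (h : IsLogQuotient f ℓ) :
    bazilevicExpr lam mu f ℓ =ᶠ[𝓝 0]
      fun z ↦ exp ((mu : ℂ) * ℓ z) * (1 + (lam : ℂ) * (z * deriv ℓ z)) := by
  have hf : f =ᶠ[𝓝 0] fun z ↦ z * exp (ℓ z) := eventually_of_mem unitDisk_mem_nhds h.eq_mul_exp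
  filter_upwards [hf.eventuallyEq_nhds, (analyticAt_zero h.analytic).eventually_analyticAt]
    with z hz hℓ
  have hd : deriv f z = 1 * exp (ℓ z) + z * (exp (ℓ z) * deriv ℓ z) := by
    rw [hz.deriv_eq]
    exact ((hasDerivAt_id' z).mul hℓ.differentiableAt.hasDerivAt.cexp).deriv
  have he : exp ((mu : ℂ) * ℓ z) = exp (ℓ z) * exp (((mu : ℂ) - 1) * ℓ z) := by
    rw [← exp_add]; congr 1; ring
  rw [bazilevicExpr, hd, he]
  ring

/-- The coefficients of the expression defining the class, in terms of those of `f`. -/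
lemma coeff_bazilevicExpr (lam mu : ℝ) {f ℓ : ℂ → ℂ} (h : IsLogQuotient f ℓ) :
    coeff (bazilevicExpr lam mu f ℓ) 0 = 1 ∧
    coeff (bazilevicExpr lam mu f ℓ) 1 = (lam + mu) * coeff f 2 ∧
    coeff (bazilevicExpr lam mu f ℓ) 2 =
      (2 * lam + mu) * (coeff f 3 + (mu - 1) / 2 * coeff f 2 ^ 2) ∧
    coeff (bazilevicExpr lam mu f ℓ) 3 =
      (3 * lam + mu) * (coeff f 4 + (mu - 1) * coeff f 2 * coeff f 3
        + (mu - 1) * (mu - 2) / 6 * coeff f 2 ^ 3) := by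
  have aℓ := analyticAt_zero h.analytic
  obtain ⟨-, q1, q2, q3⟩ := coeff_exp_mul aℓ h.map_zero 1
  simp only [one_mul, one_pow, ← coeff_of_isLogQuotient h, Nat.reduceAdd] at q1 q2 q3
  obtain ⟨p0, p1, p2, p3⟩ := coeff_exp_mul aℓ h.map_zero mu
  have aP : AnalyticAt ℂ (fun z ↦ exp ((mu : ℂ) * ℓ z)) 0 := (analyticAt_const.mul aℓ).cexp
  have az : AnalyticAt ℂ (fun z ↦ (lam : ℂ) * (z * deriv ℓ z)) 0 :=
    analyticAt_const.mul (analyticAt_id_mul aℓ.deriv)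
  have aQ : AnalyticAt ℂ (fun z ↦ 1 + (lam : ℂ) * (z * deriv ℓ z)) 0 := analyticAt_const.add az
  have l0 : coeff (fun z ↦ 1 + (lam : ℂ) * (z * deriv ℓ z)) 0 = 1 := by simp [coeff_zero]
  have l1 : ∀ n : ℕ, coeff (fun z ↦ 1 + (lam : ℂ) * (z * deriv ℓ z)) (n + 1) =
      lam * ((n + 1) * coeff ℓ (n + 1)) := fun n ↦ by
    rw [coeff_add analyticAt_const az, coeff_const_succ, coeff_const_mul, coeff_id_mul aℓ.deriv,
      zero_add, coeff_deriv]
  have hev := bazilevicExpr_eventuallyEq (lam := lam) (mu := mu) h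
  rw [coeff_congr hev, coeff_congr hev, coeff_congr hev, coeff_congr hev, coeff_mul_zero,
    coeff_mul_one aP aQ, coeff_mul_two aP aQ, coeff_mul_three aP aQ, l0, l1 0, l1 1, l1 2,
    p0, p1, p2, p3, q1, q2, q3]
  norm_num
  refine ⟨?_, ?_, ?_⟩ <;> ring

/-- The coefficients of `H ∘ w`, from `(1 - 2 t w + w²) (H ∘ w) = 1`. -/
lemma coeff_chebyshevH_comp (t : ℝ) {F w : ℂ → ℂ} (aF : AnalyticAt ℂ F 0) (aw : AnalyticAt ℂ w 0)
    (hw0 : w 0 = 0) (h : F =ᶠ[𝓝 0] fun z ↦ chebyshevH t (w z)) :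
    coeff F 1 = 2 * t * coeff w 1 ∧
    coeff F 2 = 2 * t * coeff w 2 + (4 * t ^ 2 - 1) * coeff w 1 ^ 2 ∧
    coeff F 3 = 2 * t * coeff w 3 + 2 * (4 * t ^ 2 - 1) * coeff w 1 * coeff w 2
      + (8 * t ^ 3 - 4 * t) * coeff w 1 ^ 3 := by
  have aw2 : AnalyticAt ℂ (fun z ↦ w z * (w z + -(2 * t))) 0 :=
    aw.mul (aw.add analyticAt_const)
  have aD : AnalyticAt ℂ (fun z ↦ 1 + w z * (w z + -(2 * t))) 0 := analyticAt_const.add aw2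
  have hne : ∀ᶠ z in 𝓝 (0 : ℂ), 1 + w z * (w z + -(2 * t)) ≠ 0 :=
    aD.continuousAt.eventually_ne (by simp [hw0])
  have hev : (fun z ↦ (1 + w z * (w z + -(2 * t))) * F z) =ᶠ[𝓝 0] fun _ ↦ 1 := by
    filter_upwards [h, hne] with z hz hz'
    have e : 1 - 2 * (t : ℂ) * w z + w z ^ 2 = 1 + w z * (w z + -(2 * t)) := by ring
    rw [hz, chebyshevH, e, mul_one_div_cancel hz']
  have w0 : coeff w 0 = 0 := by rw [coeff_zero, hw0]
  have s0 : coeff (fun z ↦ w z + -(2 * (t : ℂ))) 0 = -(2 * t) := by simp [coeff_zero, hw0]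
  have s1 : ∀ n, coeff (fun z ↦ w z + -(2 * (t : ℂ))) (n + 1) = coeff w (n + 1) := fun n ↦ by
    rw [coeff_add aw analyticAt_const, coeff_const_succ, add_zero]
  have as : AnalyticAt ℂ (fun z ↦ w z + -(2 * (t : ℂ))) 0 := aw.add analyticAt_const
  have d0 : coeff (fun z ↦ 1 + w z * (w z + -(2 * (t : ℂ)))) 0 = 1 := by simp [coeff_zero, hw0]
  have d : ∀ n, coeff (fun z ↦ 1 + w z * (w z + -(2 * (t : ℂ)))) (n + 1) =
      coeff (fun z ↦ w z * (w z + -(2 * (t : ℂ)))) (n + 1) := fun n ↦ by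
    rw [coeff_add analyticAt_const aw2, coeff_const_succ, zero_add]
  have d1 := d 0
  have d2 := d 1
  have d3 := d 2
  norm_num at d1 d2 d3
  rw [coeff_mul_one aw as, w0, s0] at d1
  rw [coeff_mul_two aw as, w0, s0, s1 0] at d2
  rw [coeff_mul_three aw as, w0, s0, s1 0, s1 1] at d3
  have e0 := coeff_congr hev 0
  have e1 := coeff_congr hev 1
  have e2 := coeff_congr hev 2
  have e3 := coeff_congr hev 3
  rw [coeff_mul_zero, coeff_zero (fun _ ↦ 1), d0, one_mul] at e0
  rw [coeff_mul_one aD aF, d0, d1, e0, coeff_const_succ] at e1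
  rw [coeff_mul_two aD aF, d0, d1, d2, e0, coeff_const_succ] at e2
  rw [coeff_mul_three aD aF, d0, d1, d2, d3, e0, coeff_const_succ] at e3
  norm_num at e1 e2 e3
  have e1' : coeff F 1 = 2 * t * coeff w 1 := by linear_combination e1
  rw [e1'] at e2 e3
  have e2' : coeff F 2 = 2 * t * coeff w 2 + (4 * t ^ 2 - 1) * coeff w 1 ^ 2 := by
    linear_combination e2
  rw [e2'] at e3
  exact ⟨e1', e2', by linear_combination e3⟩

lemma analyticAt_bazilevicExpr (lam mu : ℝ) {f ℓ : ℂ → ℂ} (h : IsLogQuotient f ℓ) :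
    AnalyticAt ℂ (bazilevicExpr lam mu f ℓ) 0 := by
  have aℓ := analyticAt_zero h.analytic
  refine AnalyticAt.congr ?_ (bazilevicExpr_eventuallyEq h).symm
  exact (analyticAt_const.mul aℓ).cexp.mul
    (analyticAt_const.add (analyticAt_const.mul (analyticAt_id_mul aℓ.deriv)))

/-- The subordination condition as equations between the coefficients of `f` and those of the
Schwarz function `w`. -/
lemma exists_coeff_eq_of_satisfiesSubordination {lam mu t : ℝ} {f : ℂ → ℂ}
    (h : SatisfiesSubordination lam mu t f) :
    ∃ w : ℂ → ℂ, DifferentiableOn ℂ w unitDisk ∧ w 0 = 0 ∧ (∀ z ∈ unitDisk, ‖w z‖ < 1) ∧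
      (lam + mu) * coeff f 2 = 2 * t * coeff w 1 ∧
      (2 * lam + mu) * (coeff f 3 + (mu - 1) / 2 * coeff f 2 ^ 2) =
        2 * t * coeff w 2 + (4 * t ^ 2 - 1) * coeff w 1 ^ 2 ∧
      (3 * lam + mu) * (coeff f 4 + (mu - 1) * coeff f 2 * coeff f 3
          + (mu - 1) * (mu - 2) / 6 * coeff f 2 ^ 3) =
        2 * t * coeff w 3 + 2 * (4 * t ^ 2 - 1) * coeff w 1 * coeff w 2
          + (8 * t ^ 3 - 4 * t) * coeff w 1 ^ 3 := by
  obtain ⟨ℓ, hℓ, w, hw, hw0, hwb, hF⟩ := h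
  refine ⟨w, hw, hw0, hwb, ?_⟩
  obtain ⟨-, h1, h2, h3⟩ := coeff_bazilevicExpr lam mu hℓ
  obtain ⟨g1, g2, g3⟩ := coeff_chebyshevH_comp t (analyticAt_bazilevicExpr lam mu hℓ)
    (analyticAt_zero hw) hw0 (eventually_of_mem unitDisk_mem_nhds hF)
  exact ⟨h1 ▸ g1, h2 ▸ g2, h3 ▸ g3⟩

/-- The coefficients of the inverse function: comparing coefficients in
`(f(z) / z) (g / id)(f(z)) = 1`. -/
lemma coeff_inverse {f g ℓ m : ℂ → ℂ} (hf : IsLogQuotient f ℓ) (hg : IsLogQuotient g m)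
    (h : ∀ᶠ z in 𝓝 (0 : ℂ), g (f z) = z) :
    coeff g 2 = -coeff f 2 ∧ coeff g 3 = 2 * coeff f 2 ^ 2 - coeff f 3 ∧
      coeff g 4 = -5 * coeff f 2 ^ 3 + 5 * coeff f 2 * coeff f 3 - coeff f 4 := by
  set E : ℂ → ℂ := fun z ↦ exp (ℓ z) with hE
  set e : ℂ → ℂ := fun z ↦ exp (m z) with he
  have aE : AnalyticAt ℂ E 0 := (analyticAt_zero hf.analytic).cexp
  have ae : AnalyticAt ℂ e 0 := (analyticAt_zero hg.analytic).cexp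
  have E0 : E 0 = 1 := by simp [hE, hf.map_zero]
  have e0 : e 0 = 1 := by simp [he, hg.map_zero]
  have aC : AnalyticAt ℂ (fun z ↦ e (z * E z)) 0 := analyticAt_comp_id_mul ae aE
  have hev : (fun z ↦ E z * e (z * E z)) =ᶠ[𝓝 0] fun _ ↦ 1 := by
    have hmem : ∀ᶠ z in 𝓝 (0 : ℂ), z * E z ∈ unitDisk :=
      (analyticAt_id_mul aE).continuousAt.preimage_mem_nhds (by
        rw [zero_mul]; exact unitDisk_mem_nhds)
    filter_upwards [h, hmem, unitDisk_mem_nhds] with z hz hz1 hz2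
    rcases eq_or_ne z 0 with rfl | h0
    · rw [zero_mul, E0, e0, one_mul]
    · rw [hf.eq_mul_exp z hz2, hg.eq_mul_exp _ hz1] at hz
      refine mul_left_cancel₀ h0 ?_
      rw [mul_one, ← mul_assoc]
      exact hz
  obtain ⟨c1, c2, c3⟩ := coeff_comp ae aE E0
  have c0 : coeff (fun z ↦ e (z * E z)) 0 = 1 := by simp [coeff_zero, e0]
  have d0 : coeff E 0 = 1 := by rw [coeff_zero, E0]
  have e1 := coeff_congr hev 1
  have e2 := coeff_congr hev 2
  have e3 := coeff_congr hev 3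
  rw [coeff_mul_one aE aC, c0, c1, d0, coeff_const_succ] at e1
  rw [coeff_mul_two aE aC, c0, c1, c2, d0, coeff_const_succ] at e2
  rw [coeff_mul_three aE aC, c0, c1, c2, c3, d0, coeff_const_succ] at e3
  rw [coeff_of_isLogQuotient hf 1, coeff_of_isLogQuotient hf 2, coeff_of_isLogQuotient hf 3,
    coeff_of_isLogQuotient hg 1, coeff_of_isLogQuotient hg 2, coeff_of_isLogQuotient hg 3]
  have f1 : coeff e 1 = -coeff E 1 := by linear_combination e1
  rw [f1] at e2 e3
  have f2 : coeff e 2 = 2 * coeff E 1 ^ 2 - coeff E 2 := by linear_combination e2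
  rw [f2] at e3
  exact ⟨f1, f2, by linear_combination e3⟩

/-! ### The second Hankel determinant -/

/-- The determinant `a₂ a₄ - a₃²` in terms of the coefficients `c`, `d` of the two Schwarz
functions. Subtracting the equations for `g` from those for `f` eliminates the coefficients of
`g`. -/
lemma hankel_eq {lam mu t : ℝ} (hA : 0 < lam + mu) (hB : 0 < 2 * lam + mu)
    (hC : 0 < 3 * lam + mu) (ht : t ≠ 0) {a₂ a₃ a₄ b₂ b₃ b₄ c₁ c₂ c₃ d₁ d₂ d₃ : ℂ}
    (hb₂ : b₂ = -a₂) (hb₃ : b₃ = 2 * a₂ ^ 2 - a₃) (hb₄ : b₄ = -5 * a₂ ^ 3 + 5 * a₂ * a₃ - a₄)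
    (hf₁ : (lam + mu) * a₂ = 2 * t * c₁)
    (hf₂ : (2 * lam + mu) * (a₃ + (mu - 1) / 2 * a₂ ^ 2) = 2 * t * c₂ + (4 * t ^ 2 - 1) * c₁ ^ 2)
    (hf₃ : (3 * lam + mu) * (a₄ + (mu - 1) * a₂ * a₃ + (mu - 1) * (mu - 2) / 6 * a₂ ^ 3) =
      2 * t * c₃ + 2 * (4 * t ^ 2 - 1) * c₁ * c₂ + (8 * t ^ 3 - 4 * t) * c₁ ^ 3)
    (hg₁ : (lam + mu) * b₂ = 2 * t * d₁)
    (hg₂ : (2 * lam + mu) * (b₃ + (mu - 1) / 2 * b₂ ^ 2) = 2 * t * d₂ + (4 * t ^ 2 - 1) * d₁ ^ 2)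
    (hg₃ : (3 * lam + mu) * (b₄ + (mu - 1) * b₂ * b₃ + (mu - 1) * (mu - 2) / 6 * b₂ ^ 3) =
      2 * t * d₃ + 2 * (4 * t ^ 2 - 1) * d₁ * d₂ + (8 * t ^ 3 - 4 * t) * d₁ ^ 3) :
    d₁ = -c₁ ∧ a₂ * a₄ - a₃ ^ 2 =
      ((8 * t ^ 2 / (3 * (lam + mu) ^ 4 * (3 * lam + mu)) *
          (3 * (2 * t ^ 2 - 1) * (lam + mu) ^ 3
            - (mu ^ 2 + 3 * mu + 2) * (3 * lam + mu) * t ^ 2) : ℝ) : ℂ) * c₁ ^ 4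
      + ((2 * t ^ 3 / ((lam + mu) ^ 2 * (2 * lam + mu)) : ℝ) : ℂ) * (c₁ ^ 2 * (c₂ - d₂))
      + ((2 * t * (4 * t ^ 2 - 1) / ((lam + mu) * (3 * lam + mu)) : ℝ) : ℂ) *
          (c₁ ^ 2 * (c₂ + d₂))
      + ((2 * t ^ 2 / ((lam + mu) * (3 * lam + mu)) : ℝ) : ℂ) * (c₁ * (c₃ - d₃))
      - ((t ^ 2 / (2 * lam + mu) ^ 2 : ℝ) : ℂ) * (c₂ - d₂) ^ 2 := by
  have ht' : (t : ℂ) ≠ 0 := by exact_mod_cast ht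
  have hA' : (lam : ℂ) + mu ≠ 0 := by exact_mod_cast hA.ne'
  have hB' : 2 * (lam : ℂ) + mu ≠ 0 := by exact_mod_cast hB.ne'
  have hC' : 3 * (lam : ℂ) + mu ≠ 0 := by exact_mod_cast hC.ne'
  subst hb₂ hb₃ hb₄
  have hd : d₁ = -c₁ := by
    refine mul_left_cancel₀ (mul_ne_zero two_ne_zero ht') ?_
    linear_combination -hg₁ - hf₁
  subst hd
  refine ⟨rfl, ?_⟩
  have e₂ : a₂ = 2 * t * c₁ / (lam + mu) := by
    rw [eq_div_iff hA']; linear_combination hf₁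
  have e₃ : a₃ = a₂ ^ 2 + t * (c₂ - d₂) / (2 * lam + mu) := by
    have : a₃ - a₂ ^ 2 = t * (c₂ - d₂) / (2 * lam + mu) := by
      rw [eq_div_iff hB']; linear_combination (hf₂ - hg₂) / 2
    linear_combination this
  have e₄ : a₄ = 5 / 2 * a₂ * (a₃ - a₂ ^ 2) - (mu ^ 2 + 3 * mu - 4) / 6 * a₂ ^ 3
      + (t * (c₃ - d₃) + (4 * t ^ 2 - 1) * c₁ * (c₂ + d₂) + (8 * t ^ 3 - 4 * t) * c₁ ^ 3)
        / (3 * lam + mu) := by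
    have : a₄ - 5 / 2 * a₂ * (a₃ - a₂ ^ 2) + (mu ^ 2 + 3 * mu - 4) / 6 * a₂ ^ 3 =
        (t * (c₃ - d₃) + (4 * t ^ 2 - 1) * c₁ * (c₂ + d₂) + (8 * t ^ 3 - 4 * t) * c₁ ^ 3)
          / (3 * lam + mu) := by
      rw [eq_div_iff hC']; linear_combination (hf₃ - hg₃) / 2
    linear_combination this
  rw [e₄, e₃, e₂]
  push_cast
  generalize (lam : ℂ) + mu = A at hA' ⊢
  generalize 2 * (lam : ℂ) + mu = B at hB' ⊢
  generalize 3 * (lam : ℂ) + mu = C at hC' ⊢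
  field_simp
  ring

/-- The triangle inequality bound increases with the parameters `X`, `Y` of the second
coefficients, hence is largest for `X = Y = 1`. -/
lemma schwarz_parameter_bound {p q r s X Y : ℝ} (hp : 0 ≤ p) (hs0 : 0 ≤ s) (hs1 : s ≤ 1)
    (hq : 0 ≤ q) (hqr : q * s ≤ 2 * r * (1 + s)) (hX0 : 0 ≤ X) (hX1 : X ≤ 1) (hY0 : 0 ≤ Y)
    (hY1 : Y ≤ 1) :
    p * (s ^ 2 * ((1 - s ^ 2) * X + (1 - s ^ 2) * Y))
        + q * (s * ((1 - s ^ 2) * (1 - X ^ 2 + s * X ^ 2) + (1 - s ^ 2) * (1 - Y ^ 2 + s * Y ^ 2)))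
        + r * ((1 - s ^ 2) * X + (1 - s ^ 2) * Y) ^ 2
      ≤ 2 * (p + q) * s ^ 2 * (1 - s ^ 2) + 4 * r * (1 - s ^ 2) ^ 2 := by
  have hv : 0 ≤ 1 - s ^ 2 := sub_nonneg.mpr (pow_le_one₀ hs0 hs1)
  have hS : 0 ≤ 4 - (X + Y) ^ 2 := by nlinarith
  have h1 : 0 ≤ p * (s ^ 2 * (2 - (X + Y))) :=
    mul_nonneg hp (mul_nonneg (sq_nonneg s) (by linarith))
  -- `2 - X² - Y² ≤ (4 - (X + Y)²) / 2`
  have h2 : 0 ≤ q * s * (1 - s) * (X - Y) ^ 2 :=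
    mul_nonneg (mul_nonneg (mul_nonneg hq hs0) (sub_nonneg.mpr hs1)) (sq_nonneg _)
  have h3 : 0 ≤ (2 * r * (1 + s) - q * s) * ((1 - s) * (4 - (X + Y) ^ 2)) :=
    mul_nonneg (sub_nonneg.mpr hqr) (mul_nonneg (sub_nonneg.mpr hs1) hS)
  have h : 0 ≤ (1 - s ^ 2) * (p * (s ^ 2 * (2 - (X + Y))) + q * s * (1 - s) * (X - Y) ^ 2 / 2
      + (2 * r * (1 + s) - q * s) * ((1 - s) * (4 - (X + Y) ^ 2)) / 2) :=
    mul_nonneg hv (by linarith)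
  linear_combination h

/-- The estimate from which all cases follow: for `u = |c₁|² ∈ [0, 1]` the determinant is bounded
by a quadratic polynomial in `u` with coefficients given by `M₁` and `M₂`. -/
lemma exists_norm_hankel_le {lam mu t : ℝ} (hlam : 1 ≤ lam) (hmu : 0 ≤ mu)
    (ht : t ∈ Set.Ioc (1 / 2 : ℝ) 1) {f : ℂ → ℂ} (hf : ClassN lam mu t f) :
    ∃ u : ℝ, 0 ≤ u ∧ u ≤ 1 ∧ ‖coeff f 2 * coeff f 4 - coeff f 3 ^ 2‖ ≤
      4 * t ^ 2 / (2 * lam + mu) ^ 2 + (M₁ lam mu t * u ^ 2 + 3 * M₂ lam mu t * u)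
        / (6 * (lam + mu) ^ 4 * (2 * lam + mu) ^ 2 * (3 * lam + mu)) := by
  obtain ⟨-, hsf, g, hg, hsg⟩ := hf
  obtain ⟨w, hw, hw0, hwb, hf₁, hf₂, hf₃⟩ := exists_coeff_eq_of_satisfiesSubordination hsf
  obtain ⟨v, hv, hv0, hvb, hg₁, hg₂, hg₃⟩ := exists_coeff_eq_of_satisfiesSubordination hsg
  obtain ⟨ℓ, hℓ, -⟩ := hsf
  obtain ⟨m, hm, -⟩ := hsg
  obtain ⟨hb₂, hb₃, hb₄⟩ := coeff_inverse hℓ hm hg.left_inverse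
  have ht0 : 0 < t := by linarith [ht.1]
  have hA : 0 < lam + mu := by linarith
  have hB : 0 < 2 * lam + mu := by linarith
  have hC : 0 < 3 * lam + mu := by linarith
  obtain ⟨hd, hH⟩ := hankel_eq hA hB hC ht0.ne' hb₂ hb₃ hb₄ hf₁ hf₂ hf₃ hg₁ hg₂ hg₃
  obtain ⟨hs1, X, hX0, hX1, hc₂, hc₃⟩ := schwarz_coeff hw hw0 hwb
  obtain ⟨-, Y, hY0, hY1, hd₂, hd₃⟩ := schwarz_coeff hv hv0 hvb
  rw [hd, norm_neg] at hd₂ hd₃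
  set s := ‖coeff w 1‖ with hs
  have hs0 : 0 ≤ s := norm_nonneg _
  refine ⟨s ^ 2, sq_nonneg s, pow_le_one₀ hs0 hs1, ?_⟩
  rw [hH]
  set N : ℝ := 3 * (2 * t ^ 2 - 1) * (lam + mu) ^ 3
    - (mu ^ 2 + 3 * mu + 2) * (3 * lam + mu) * t ^ 2 with hN
  set k : ℝ := 8 * t ^ 2 / (3 * (lam + mu) ^ 4 * (3 * lam + mu)) with hk
  set p₁ : ℝ := 2 * t ^ 3 / ((lam + mu) ^ 2 * (2 * lam + mu)) with hp₁
  set p₂ : ℝ := 2 * t * (4 * t ^ 2 - 1) / ((lam + mu) * (3 * lam + mu)) with hp₂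
  set q : ℝ := 2 * t ^ 2 / ((lam + mu) * (3 * lam + mu)) with hq
  set r : ℝ := t ^ 2 / (2 * lam + mu) ^ 2 with hr
  have hk0 : 0 ≤ k := by positivity
  have hp₁0 : 0 ≤ p₁ := by positivity
  have hp₂0 : 0 ≤ p₂ := div_nonneg
    (mul_nonneg (by positivity) (by nlinarith [ht.1])) (by positivity)
  have hq0 : 0 ≤ q := by positivity
  have hr0 : 0 ≤ r := by positivity
  -- `(2λ + μ)² ≤ 4/3 (λ + μ)(3λ + μ)`, whereas `s ≤ 3/4 (1 + s)`
  have hqr : q * s ≤ 2 * r * (1 + s) := by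
    have h1 : 3 * (2 * lam + mu) ^ 2 ≤ 4 * ((lam + mu) * (3 * lam + mu)) := by nlinarith
    have h2 : s * (2 * lam + mu) ^ 2 ≤ (1 + s) * ((lam + mu) * (3 * lam + mu)) := by
      have h3 : 0 ≤ (1 - s) * ((lam + mu) * (3 * lam + mu)) :=
        mul_nonneg (sub_nonneg.mpr hs1) (by positivity)
      have h4 := mul_le_mul_of_nonneg_left h1 hs0
      nlinarith [mul_pos hA hC]
    have h5 : s / ((lam + mu) * (3 * lam + mu)) ≤ (1 + s) / (2 * lam + mu) ^ 2 := by
      rw [div_le_div_iff₀ (by positivity) (by positivity)]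
      exact h2
    calc q * s = 2 * t ^ 2 * (s / ((lam + mu) * (3 * lam + mu))) := by rw [hq]; ring
      _ ≤ 2 * t ^ 2 * ((1 + s) / (2 * lam + mu) ^ 2) := by gcongr
      _ = 2 * r * (1 + s) := by rw [hr]; ring
  have hreal : ∀ {x : ℝ} (z : ℂ), 0 ≤ x → ‖(x : ℂ) * z‖ = x * ‖z‖ := fun z hx ↦ by
    rw [norm_mul, Complex.norm_real, Real.norm_of_nonneg hx]
  have hsub₂ : ‖coeff w 2 - coeff v 2‖ ≤ (1 - s ^ 2) * X + (1 - s ^ 2) * Y :=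
    (norm_sub_le _ _).trans (add_le_add hc₂ hd₂)
  have hadd₂ : ‖coeff w 2 + coeff v 2‖ ≤ (1 - s ^ 2) * X + (1 - s ^ 2) * Y :=
    (norm_add_le _ _).trans (add_le_add hc₂ hd₂)
  have hsub₃ : ‖coeff w 3 - coeff v 3‖ ≤
      (1 - s ^ 2) * (1 - X ^ 2 + s * X ^ 2) + (1 - s ^ 2) * (1 - Y ^ 2 + s * Y ^ 2) :=
    (norm_sub_le _ _).trans (add_le_add hc₃ hd₃)
  have hpar := schwarz_parameter_bound (p := p₁ + p₂) (add_nonneg hp₁0 hp₂0) hs0 hs1 hq0 hqr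
    hX0 hX1 hY0 hY1
  calc _ ≤ k * |N| * s ^ 4
        + p₁ * (s ^ 2 * ((1 - s ^ 2) * X + (1 - s ^ 2) * Y))
        + p₂ * (s ^ 2 * ((1 - s ^ 2) * X + (1 - s ^ 2) * Y))
        + q * (s * ((1 - s ^ 2) * (1 - X ^ 2 + s * X ^ 2) + (1 - s ^ 2) * (1 - Y ^ 2 + s * Y ^ 2)))
        + r * ((1 - s ^ 2) * X + (1 - s ^ 2) * Y) ^ 2 := by
        refine (norm_sub_le _ _).trans (add_le_add ((norm_add_le _ _).trans (add_le_add
          ((norm_add_le _ _).trans (add_le_add ((norm_add_le _ _).trans (add_le_add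
            ?_ ?_)) ?_)) ?_)) ?_)
        · rw [norm_mul, Complex.norm_real, norm_mul, Real.norm_of_nonneg hk0, Real.norm_eq_abs,
            norm_pow]
        · rw [hreal _ hp₁0, norm_mul, norm_pow]; gcongr
        · rw [hreal _ hp₂0, norm_mul, norm_pow]; gcongr
        · rw [hreal _ hq0, norm_mul]; gcongr
        · rw [hreal _ hr0, norm_pow]; gcongr
    _ ≤ k * |N| * s ^ 4
        + (2 * (p₁ + p₂ + q) * s ^ 2 * (1 - s ^ 2) + 4 * r * (1 - s ^ 2) ^ 2) := by
        linear_combination hpar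
    _ = _ := by
        rw [M₁, M₂, ← hN, hk, hp₁, hp₂, hq, hr]
        field_simp
        ring

end ChebyshevBiUnivalent

theorem theorem1 (lam mu t : ℝ) (hlam : 1 ≤ lam) (hmu : 0 ≤ mu) (ht : t ∈ Set.Ioc (1 / 2 : ℝ) 1)
    (f : ℂ → ℂ) (hf : ChebyshevBiUnivalent.ClassN lam mu t f) :
    (0 ≤ ChebyshevBiUnivalent.M₁ lam mu t → 0 ≤ ChebyshevBiUnivalent.M₂ lam mu t →
      ‖ChebyshevBiUnivalent.coeff f 2 * ChebyshevBiUnivalent.coeff f 4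
          - ChebyshevBiUnivalent.coeff f 3 ^ 2‖
        ≤ ChebyshevBiUnivalent.KTwo lam mu t) ∧
    (0 < ChebyshevBiUnivalent.M₁ lam mu t → ChebyshevBiUnivalent.M₂ lam mu t < 0 →
      ‖ChebyshevBiUnivalent.coeff f 2 * ChebyshevBiUnivalent.coeff f 4
          - ChebyshevBiUnivalent.coeff f 3 ^ 2‖
        ≤ max (4 * t ^ 2 / (2 * lam + mu) ^ 2) (ChebyshevBiUnivalent.KTwo lam mu t)) ∧
    (ChebyshevBiUnivalent.M₁ lam mu t ≤ 0 → ChebyshevBiUnivalent.M₂ lam mu t ≤ 0 →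
      ‖ChebyshevBiUnivalent.coeff f 2 * ChebyshevBiUnivalent.coeff f 4
          - ChebyshevBiUnivalent.coeff f 3 ^ 2‖
        ≤ 4 * t ^ 2 / (2 * lam + mu) ^ 2) ∧
    (ChebyshevBiUnivalent.M₁ lam mu t < 0 → 0 < ChebyshevBiUnivalent.M₂ lam mu t →
      ‖ChebyshevBiUnivalent.coeff f 2 * ChebyshevBiUnivalent.coeff f 4
          - ChebyshevBiUnivalent.coeff f 3 ^ 2‖
        ≤ max (ChebyshevBiUnivalent.KCrit lam mu t) (ChebyshevBiUnivalent.KTwo lam mu t)) := by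
  obtain ⟨u, hu0, hu1, h⟩ := ChebyshevBiUnivalent.exists_norm_hankel_le hlam hmu ht hf
  rw [ChebyshevBiUnivalent.KTwo, ChebyshevBiUnivalent.KCrit]
  set m₁ := ChebyshevBiUnivalent.M₁ lam mu t
  set m₂ := ChebyshevBiUnivalent.M₂ lam mu t
  have hD : 0 < 6 * (lam + mu) ^ 4 * (2 * lam + mu) ^ 2 * (3 * lam + mu) := by positivity
  have hu2 : u ^ 2 ≤ 1 := pow_le_one₀ hu0 hu1
  have hu2' : u ^ 2 ≤ u := by nlinarith
  refine ⟨fun h₁ h₂ ↦ h.trans ?_, fun h₁ h₂ ↦ h.trans ?_, fun h₁ h₂ ↦ h.trans ?_,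
    fun h₁ h₂ ↦ (h.trans ?_).trans (le_max_left _ _)⟩
  · gcongr _ + ?_ / _
    nlinarith
  · -- a convex function of `u` is largest at an endpoint
    rcases le_total (m₁ + 3 * m₂) 0 with h₃ | h₃
    · refine le_max_of_le_left (add_le_of_nonpos_right (div_nonpos_of_nonpos_of_nonneg ?_ hD.le))
      nlinarith
    · refine le_max_of_le_right ?_
      gcongr _ + ?_ / _
      nlinarith
  · refine add_le_of_nonpos_right (div_nonpos_of_nonpos_of_nonneg ?_ hD.le)
    nlinarith [sq_nonneg u]
  · -- complete the square: the vertex is at `u = -3 M₂ / (2 M₁)`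
    have hsq : m₁ * u ^ 2 + 3 * m₂ * u ≤ -(9 * m₂ ^ 2 / (4 * m₁)) := by
      rw [← neg_div_neg_eq, ← sub_nonneg]
      have : -(-(9 * m₂ ^ 2) / -(4 * m₁)) - (m₁ * u ^ 2 + 3 * m₂ * u) =
          (2 * m₁ * u + 3 * m₂) ^ 2 / (4 * -m₁) := by
        have := h₁.ne
        field_simp
        ring
      rw [this]
      have : 0 < -m₁ := neg_pos.mpr h₁
      positivity
    have : 4 * t ^ 2 / (2 * lam + mu) ^ 2
          - 3 * m₂ ^ 2 / (8 * m₁ * (lam + mu) ^ 4 * (2 * lam + mu) ^ 2 * (3 * lam + mu)) =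
        4 * t ^ 2 / (2 * lam + mu) ^ 2 + -(9 * m₂ ^ 2 / (4 * m₁))
          / (6 * (lam + mu) ^ 4 * (2 * lam + mu) ^ 2 * (3 * lam + mu)) := by
      have := h₁.ne
      field_simp
      ring
    rw [this]
    gcongr
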